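/- An \emph{oriented list defective coloring} (OLDC) instance consists of a finite directed graph $G=(V,E)$ without self-loops, a finite color space $\mathcal C\subseteq\mathbb N$, and for every $v\in V$ a list $L_v\subseteq\mathcal C$ and a defect function $d_v:L_v\to\mathbb N_0$. A solution is a map $\varphi:V\to\mathcal C$ such that every $v$ satisfies $\varphi(v)\in L_v$ and has at most $d_v(\varphi(v))$ out-neighbors $u$ with $\varphi(u)=\varphi(v)$. Let $\beta_v$ be the maximum of $1$ and the outdegree of $v$. Algorithms are deterministic algorithms in the LOCAL model: nodes have unique identifiers; in each synchronous round every node sends an arbitrary message to each neighbor (edges can be used in both directions) and computes arbitrarily; after the last round every node outputs its color. Each node initially knows its identifier, its color in a given proper $m$-coloring of $G$, its list and defects, and the identifiers of its in- and out-neighbors. All nodes know upper bounds $n$ on $|V|$, $N$ on the identifiers, $\Delta$ on the (undirected) degrees, $\beta$ on all $\beta_v$, $\Lambda\ge 1$ on all $|L_v|$, as well as $m$ and $\mathcal C$. Let $\log=\log_2$, and let $\log^* m$ be the number of times $\log$ has to be iterated on $m$ to reach a value at most $1$. \textbf{Corollary.} For all $a,b\in\mathbb N$ there is a constant $c>0$,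 depending only on $a$ and $b$, such that the following holds for every real $\nu\ge 0$, every non-decreasing function $\kappa:\mathbb N\to\mathbb R$ and all integers $n,N,\Delta,\beta$ with $2\le\beta\le\Delta<n\le N$. Suppose that for all $\Lambda\ge1$, all $m$ and all finite color spaces $\mathcal C$, there is a deterministic algorithm that solves in at most $a\Lambda^a+a\log^* m$ rounds all OLDC instances with these parameters for which \[\forall v\in V:\ \sum_{x\in L_v}(d_v(x)+1)^{1+\nu}\ \ge\ \beta_v^{1+\nu}\cdot\kappa(\Lambda).\] Then for all $\Lambda\ge1$, all $m$ and all color spaces $\mathcal C$ with $|\mathcal C|\le b\beta^b$, there is a deterministic algorithm that solves in at most \[2^{c\sqrt{\log\beta\cdot\log\kappa(\Lambda)}}+c\log^* m\] rounds all OLDC instances with these parameters for which \[\forall v\in V:\ \sum_{x\in L_v}(d_v(x)+1)^{1+\nu}\ \ge\ \beta_v^{1+\nu}\cdot 2^{c\sqrt{\log\beta\cdot\log\kappa(\Lambda)}}.\] -/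

import Mathlib

namespace OLDC

/-- The iterated logarithm `log* m`: how often `m ↦ ⌈log₂ m⌉` has to be applied to get down to a
value that is at most `1`. (For integers, rounding up in each step does not change this number.) -/
noncomputable def logStar (m : ℕ) : ℕ :=
  sInf {k : ℕ | (fun x : ℕ => Nat.clog 2 x)^[k] m ≤ 1}

/-- A directed communication network together with the data of an oriented list defective coloring
problem: node identifiers, an initial vertex coloring, a color list `L_v` for every node and a
defect function `d_v` (only its values on `L_v` matter). Colors are natural numbers. -/
structure Instance (V : Type) where
  graph : Digraph V
  ident : V → ℕ
  initColor : V → ℕ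
  list : V → Finset ℕ
  defect : V → ℕ → ℕ

namespace Instance

variable {V : Type} (I : Instance V)

/-- The set of out-neighbors of `v`. -/
def outNbrs (v : V) : Set V := {u | I.graph.Adj v u}

/-- Neighbors in the communication network: the direction of the edges is ignored. -/
def IsNbr (u v : V) : Prop := I.graph.Adj u v ∨ I.graph.Adj v u

/-- The degree of `v` in the underlying undirected graph. -/
noncomputable def deg (v : V) : ℕ := Set.ncard {u | I.IsNbr u v}

/-- `β_v`, the maximum of `1` and the outdegree of `v`. -/
noncomputable def beta (v : V) : ℕ := max 1 (I.outNbrs v).ncard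

/-- The sum of `(d_v(x) + 1) ^ (1 + ν)` over all colors `x ∈ L_v`. -/
noncomputable def weight (ν : ℝ) (v : V) : ℝ :=
  ∑ x ∈ I.list v, ((I.defect v x : ℝ) + 1) ^ (1 + ν)

/-- `φ` is an oriented list defective coloring: every node `v` gets a color from its list, and at
most `d_v(φ(v))` out-neighbors of `v` get the same color as `v`. -/
def IsSolution (φ : V → ℕ) : Prop :=
  ∀ v, φ v ∈ I.list v ∧ {u | u ∈ I.outNbrs v ∧ φ u = φ v}.ncard ≤ I.defect v (φ v)

end Instance

/-- The global quantities which κ may depend on and which all nodes know: an upper bound `n` on the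
number of nodes, the size `N` of the space of identifiers, an upper bound `Δ` on the degrees and
an upper bound `β` on all `β_v`. -/
structure Globals where
  n : ℕ
  N : ℕ
  Δ : ℕ
  β : ℕ

/-- The instance obeys the global quantities `P`, identifiers are unique, the initial coloring is a
proper `m`-coloring, all lists consist of colors of `𝒞` and have at most `Λ` elements. -/
structure Instance.Admissible {V : Type} (I : Instance V) (P : Globals) (m Λ : ℕ)
    (𝒞 : Finset ℕ) : Prop where
  card_le : Nat.card V ≤ P.n
  ident_lt : ∀ v, I.ident v < P.N
  ident_injective : Function.Injective I.ident
  deg_le : ∀ v, I.deg v ≤ P.Δ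
  beta_le : ∀ v, I.beta v ≤ P.β
  initColor_lt : ∀ v, I.initColor v < m
  initColor_proper : ∀ u v, I.graph.Adj u v → I.initColor u ≠ I.initColor v
  list_subset : ∀ v, I.list v ⊆ 𝒞
  list_card_le : ∀ v, (I.list v).card ≤ Λ

/-- What a node knows about the instance before the first round. -/
structure LocalInput where
  ident : ℕ
  initColor : ℕ
  outIdents : Set ℕ
  inIdents : Set ℕ
  list : Finset ℕ
  defect : ℕ → ℕ

/-- The local input of the node `v` in the instance `I`. -/
def Instance.localInput {V : Type} (I : Instance V) (v : V) : LocalInput where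
  ident := I.ident v
  initColor := I.initColor v
  outIdents := {i | ∃ u, I.graph.Adj v u ∧ I.ident u = i}
  inIdents := {i | ∃ u, I.graph.Adj u v ∧ I.ident u = i}
  list := I.list v
  defect := I.defect v

/-- A deterministic distributed algorithm in the LOCAL model. Internal computations and the size of
the messages are unrestricted. -/
structure Algorithm where
  /-- The type of the internal states of a node. -/
  State : Type
  /-- The type of the messages. -/
  Msg : Type
  /-- The state before the first round. -/
  start : LocalInput → State
  /-- The message that a node sends to its neighbor with the given identifier. -/
  send : State → ℕ → Msg
  /-- The new state, given the messages of the round, indexed by the identifier of the sender. -/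
  receive : State → (ℕ → Option Msg) → State
  /-- The color that a node in the given state outputs if it stops there. -/
  output : State → ℕ

namespace Algorithm

variable (A : Algorithm) {V : Type} (I : Instance V)

open Classical in
/-- What `v` receives in a round from identifier `i`, if `st` are the states before that round:
nothing if `i` is not the identifier of a neighbor of `v`, the message for `v` otherwise. -/
noncomputable def inbox (st : V → A.State) (v : V) (i : ℕ) : Option A.Msg :=
  (Function.partialInv I.ident i).bind fun u =>
    if I.IsNbr u v then some (A.send (st u) (I.ident v)) else none

/-- The states of all nodes after a number of synchronous rounds. -/
noncomputable def run : ℕ → V → A.State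
  | 0 => fun v => A.start (I.localInput v)
  | t + 1 => fun v => A.receive (run t v) (A.inbox I (run t) v)

/-- The color of `v` if all nodes stop after `T` rounds. -/
noncomputable def coloring (T : ℕ) (v : V) : ℕ := A.output (A.run I T v)

end Algorithm

/-- There is a deterministic distributed algorithm, which may depend on all listed quantities, that
within `T` rounds solves every admissible oriented list defective coloring instance satisfying
`∑_{x ∈ L_v} (d_v(x) + 1) ^ (1 + ν) ≥ β_v ^ (1 + ν) * K` for all nodes `v`. -/
def SolvableInRounds (P : Globals) (m Λ : ℕ) (𝒞 : Finset ℕ) (ν K : ℝ) (T : ℕ) : Prop :=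
  ∃ A : Algorithm, ∀ (V : Type) [Fintype V] (I : Instance V), I.Admissible P m Λ 𝒞 →
    (∀ v, (I.beta v : ℝ) ^ (1 + ν) * K ≤ I.weight ν v) → I.IsSolution (A.coloring I T)

end OLDC

/-!
The idea is to split a large color space into few blocks, to let the nodes first choose blocks and
then, recursively and in parallel inside all blocks, colors.

*Color space reduction* (`SolvableInRounds.colorSpaceReduction`). Let the color space consist of `p`
blocks of size `S`. Choosing blocks is an OLDC problem with `p` colors: if the colors of `L_v` in
block `i` have weight `W_i`, give block `i` the defect `⌊(W_i / Q) ^ (1 / (1 + ν))⌋`. If the total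
weight is at least `β_v ^ (1 + ν) * (q * Q)`, the weight in this problem is at least
`β_v ^ (1 + ν) * q`. Once it is solved, the edges between different blocks can be dropped, and the
outdegrees that remain are so small that the weight condition holds with the factor `Q` inside the
blocks. So the factors of the two levels multiply, and the numbers of rounds add up. Iterating this,
a space of `p ^ k` colors costs a factor `κ(p) ^ k` and `k` runs of the given algorithm for lists of
size `p` (`SolvableInRounds.iterate_colorSpaceReduction`).

*The initial coloring.* The term `log* m` must not be paid on every level. The `j`-th out-edges of
all nodes form a pseudoforest for each `j < β`; Cole–Vishkin color reduction on all of them in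
parallel turns the `m`-coloring into an `8 ^ β`-coloring within `log* m` rounds (`cvCode_proper`),
and `log* (8 ^ β) = O(log β)`.

*Parameters.* Let `s = √(log β * log κ(Λ))`. The directed triangle shows that `κ(1) > 1` and
`κ(2) > 2` (`lt_of_solvable`), so `log κ(Λ) ≥ 1` unless `Λ = 1`. If `Λ = 1` or `κ(Λ) ≥ β`, the
required weight exceeds the size of the lists, and some color of the list tolerates all
out-neighbors (`solvable_zero_of_list_card_lt`). Otherwise `log κ(Λ) ≤ s`. With `p = ⌈2 ^ s⌉`, the
given algorithm can be used directly for `Λ ≤ p`, and for `p < Λ` one has `κ(p) ≤ κ(Λ)` and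
`O(log β / s)` levels suffice (`exists_solvable_of_blocks`).
-/

namespace OLDC

/-! ### Labellings that can be computed in a number of rounds -/

variable {V : Type} {α γ : Type}

open Classical in
/-- The values of `f` at the neighbors of `v`, indexed by identifiers. -/
noncomputable def Instance.gather (I : Instance V) (f : V → α) (v : V) (i : ℕ) : Option α :=
  (Function.partialInv I.ident i).bind fun u => if I.IsNbr u v then some (f u) else none

open Classical in
lemma Instance.gather_ident (I : Instance V) (hI : Function.Injective I.ident) (f : V → α)
    (u v : V) : I.gather f v (I.ident u) = if I.IsNbr u v then some (f u) else none := by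
  simp [Instance.gather, Function.partialInv_left hI]

lemma Instance.partialInv_eq_none (I : Instance V) {i : ℕ} (hi : ∀ u, I.ident u ≠ i) :
    Function.partialInv I.ident i = none := by
  rw [Function.partialInv, dif_neg]
  simpa using hi

lemma Instance.gather_map (I : Instance V) (f : V → α) (g : α → γ) (v : V) (i : ℕ) :
    (I.gather f v i).map g = I.gather (fun u => g (f u)) v i := by
  unfold Instance.gather
  cases Function.partialInv I.ident i with
  | none => rfl
  | some u => by_cases h : I.IsNbr u v <;> simp [h]

lemma Algorithm.inbox_eq_gather (A : Algorithm) (I : Instance V) (st : V → A.State) (v : V) :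
    A.inbox I st v = I.gather (fun u => A.send (st u) (I.ident v)) v := rfl

/-- The labelling `F` of the nodes of all instances can be computed in `T` rounds: there is an
algorithm from whose state after `T` rounds every node can decode its label. -/
def ComputableIn (T : ℕ) (F : ∀ V : Type, Instance V → V → α) : Prop :=
  ∃ (A : Algorithm) (dec : A.State → α), ∀ (V : Type) (I : Instance V),
    Function.Injective I.ident → ∀ v, dec (A.run I T v) = F V I v

namespace ComputableIn

lemma congr {T : ℕ} {F G : ∀ V : Type, Instance V → V → α} (h : ComputableIn T F)
    (hFG : ∀ (V : Type) (I : Instance V), Function.Injective I.ident → ∀ v, F V I v = G V I v) :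
    ComputableIn T G := by
  obtain ⟨A, dec, hA⟩ := h
  exact ⟨A, dec, fun V I hI v => (hA V I hI v).trans (hFG V I hI v)⟩

lemma map {T : ℕ} {F : ∀ V : Type, Instance V → V → α} (h : ComputableIn T F) (g : α → γ) :
    ComputableIn T (fun V I v => g (F V I v)) := by
  obtain ⟨A, dec, hA⟩ := h
  exact ⟨A, g ∘ dec, fun V I hI v => congrArg g (hA V I hI v)⟩

lemma localInput : ComputableIn 0 (fun _ I v => I.localInput v) :=
  ⟨⟨LocalInput, Unit, id, fun _ _ => (), fun s _ => s, fun _ => 0⟩, id, fun _ _ _ _ => rfl⟩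

/-- In one more round, all nodes send their labels to all their neighbors. -/
lemma gather {T : ℕ} {F : ∀ V : Type, Instance V → V → α} (h : ComputableIn T F) :
    ComputableIn (T + 1) (fun V I v => (F V I v, I.gather (F V I) v)) := by
  obtain ⟨A, dec, hA⟩ := h
  -- Every node always attaches its label to its messages and remembers what it received last.
  let B : Algorithm :=
    { State := A.State × (α × (ℕ → Option α))
      Msg := A.Msg × α
      start := fun l => (A.start l, (dec (A.start l), fun _ => none))
      send := fun s i => (A.send s.1 i, dec s.1)
      receive := fun s ms =>
        (A.receive s.1 fun i => (ms i).map Prod.fst, (dec s.1, fun i => (ms i).map Prod.snd))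
      output := fun _ => 0 }
  have hrun : ∀ (V : Type) (I : Instance V) (t : ℕ) (v : V), (B.run I t v).1 = A.run I t v := by
    intro V I t
    induction t with
    | zero => intro v; rfl
    | succ t ih =>
      intro v
      change A.receive (B.run I t v).1 (fun i => (I.gather _ v i).map Prod.fst) = _
      simp only [Instance.gather_map, B, ih]
      rfl
  refine ⟨B, fun s => s.2, fun V I hI v => ?_⟩
  change (dec (B.run I T v).1, fun i => (I.gather _ v i).map Prod.snd) = _
  simp only [Instance.gather_map]
  have : (fun u => (B.send (B.run I T u) (I.ident v)).2) = F V I := by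
    funext u
    change dec (B.run I T u).1 = _
    rw [hrun, hA V I hI]
  rw [this, hrun, hA V I hI]

lemma mono {T T' : ℕ} {F : ∀ V : Type, Instance V → V → α} (h : ComputableIn T F) (hT : T ≤ T') :
    ComputableIn T' F := by
  induction hT with
  | refl => exact h
  | step _ ih => exact ih.gather.map Prod.fst

/-- Two algorithms can be run in parallel. -/
lemma pair {T : ℕ} {F : ∀ V : Type, Instance V → V → α} {G : ∀ V : Type, Instance V → V → γ}
    (hF : ComputableIn T F) (hG : ComputableIn T G) :
    ComputableIn T (fun V I v => (F V I v, G V I v)) := by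
  obtain ⟨A, decA, hA⟩ := hF
  obtain ⟨B, decB, hB⟩ := hG
  let C : Algorithm :=
    { State := A.State × B.State
      Msg := A.Msg × B.Msg
      start := fun l => (A.start l, B.start l)
      send := fun s i => (A.send s.1 i, B.send s.2 i)
      receive := fun s ms =>
        (A.receive s.1 fun i => (ms i).map Prod.fst, B.receive s.2 fun i => (ms i).map Prod.snd)
      output := fun _ => 0 }
  have hrun : ∀ (V : Type) (I : Instance V) (t : ℕ) (v : V),
      C.run I t v = (A.run I t v, B.run I t v) := by
    intro V I t
    induction t with
    | zero => intro v; rfl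
    | succ t ih =>
      intro v
      change (A.receive (C.run I t v).1 (fun i => (I.gather _ v i).map Prod.fst),
        B.receive (C.run I t v).2 (fun i => (I.gather _ v i).map Prod.snd)) = _
      simp only [Instance.gather_map, C, ih]
      rfl
  refine ⟨C, fun s => (decA s.1, decB s.2), fun V I hI v => ?_⟩
  simp only [hrun, hA V I hI, hB V I hI]

lemma withInput {T : ℕ} {F : ∀ V : Type, Instance V → V → α} (h : ComputableIn T F) :
    ComputableIn T (fun V I v => (I.localInput v, F V I v)) :=
  (localInput.mono (Nat.zero_le T)).pair h

/-- If the nodes have computed their local inputs for a derived instance on a subnetwork, then they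
can run any algorithm on the derived instance: the local input tells a node which of the messages
that it gets come from neighbors in the subnetwork. -/
lemma simulate {T : ℕ} (Φ : ∀ V : Type, Instance V → Instance V)
    (hid : ∀ (V : Type) (I : Instance V), (Φ V I).ident = I.ident)
    (hsub : ∀ (V : Type) (I : Instance V) (u v : V), (Φ V I).graph.Adj u v → I.graph.Adj u v)
    (h : ComputableIn T (fun V I v => (Φ V I).localInput v)) (A : Algorithm) (t : ℕ) :
    ComputableIn (T + t) (fun V I v => ((Φ V I).localInput v, A.run (Φ V I) t v)) := by
  classical
  induction t with
  | zero => exact h.map fun l => (l, A.start l)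
  | succ t ih =>
    refine (ih.gather.map fun s => (s.1.1, A.receive s.1.2 fun i =>
      if i ∈ s.1.1.outIdents ∨ i ∈ s.1.1.inIdents then
        (s.2 i).map fun r => A.send r.2 s.1.1.ident else none)).congr ?_
    intro V I hI v
    refine Prod.ext rfl ?_
    change A.receive _ _ = A.receive _ _
    congr 1
    funext i
    rw [Algorithm.inbox_eq_gather, Instance.gather_map]
    by_cases hi : ∃ u, I.ident u = i
    · obtain ⟨u, rfl⟩ := hi
      have h1 := Instance.gather_ident (Φ V I) (by rwa [hid])
        (fun u => A.send (A.run (Φ V I) t u) ((Φ V I).ident v)) u v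
      rw [hid V I] at h1
      rw [hid V I, h1, Instance.gather_ident I hI]
      have hmem : (I.ident u ∈ ((Φ V I).localInput v).outIdents ∨
          I.ident u ∈ ((Φ V I).localInput v).inIdents) ↔ (Φ V I).IsNbr u v := by
        simp only [Instance.localInput, Instance.IsNbr, Set.mem_ofPred_eq, hid, hI.eq_iff,
          exists_eq_right]
        exact or_comm
      simp only [hmem]
      by_cases hn : (Φ V I).IsNbr u v
      · have : I.IsNbr u v := hn.imp (hsub V I u v) (hsub V I v u)
        simp [hn, this, Instance.localInput, hid]
      · simp [hn]
    · push Not at hi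
      have h1 := I.partialInv_eq_none hi
      simp [Instance.gather, hid, h1]

end ComputableIn

/-- A labelling that can be computed in `T` rounds and solves the instances in question witnesses
solvability in `T` rounds. -/
lemma ComputableIn.solvable {P : Globals} {m Λ : ℕ} {𝒞 : Finset ℕ} {ν K : ℝ} {T : ℕ}
    {F : ∀ V : Type, Instance V → V → ℕ} (h : ComputableIn T F)
    (hF : ∀ (V : Type) [Fintype V] (I : Instance V), I.Admissible P m Λ 𝒞 →
      (∀ v, (I.beta v : ℝ) ^ (1 + ν) * K ≤ I.weight ν v) → I.IsSolution (F V I)) :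
    SolvableInRounds P m Λ 𝒞 ν K T := by
  obtain ⟨A, dec, hA⟩ := h
  let B : Algorithm := { A with output := dec }
  have hrun : ∀ (V : Type) (I : Instance V) (t : ℕ), B.run I t = A.run I t := by
    intro V I t
    induction t with
    | zero => rfl
    | succ t ih => funext v; simp only [Algorithm.run]; rw [ih]; rfl
  refine ⟨B, fun V _ I hI hw => ?_⟩
  have : B.coloring I T = F V I := by
    funext v
    change dec (B.run I T v) = _
    rw [hrun, hA V I hI.ident_injective]
  rw [this]
  exact hF V I hI hw

lemma SolvableInRounds.mono {P : Globals} {m Λ : ℕ} {𝒞 : Finset ℕ} {ν K K' : ℝ} {T : ℕ}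
    (h : SolvableInRounds P m Λ 𝒞 ν K T) (hK : K ≤ K') : SolvableInRounds P m Λ 𝒞 ν K' T := by
  obtain ⟨A, hA⟩ := h
  refine ⟨A, fun V _ I hI hw => hA V I hI fun v => le_trans ?_ (hw v)⟩
  gcongr

/-! ### Very easy and unsolvable instances -/

/-- If an instance is so easy that lists are shorter than `K`, then every node has a color that
tolerates all its out-neighbors, and no communication is needed. -/
lemma solvable_zero_of_list_card_lt {P : Globals} {m Λ : ℕ} {𝒞 : Finset ℕ} {ν K : ℝ}
    (hν : 0 ≤ ν) (h : ∀ L ⊆ 𝒞, L.card ≤ Λ → (L.card : ℝ) < K) :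
    SolvableInRounds P m Λ 𝒞 ν K 0 := by
  classical
  refine ComputableIn.solvable (ComputableIn.localInput.map fun l =>
    sInf {x | x ∈ l.list ∧ l.outIdents.ncard ≤ l.defect x}) ?_
  intro V _ I hI hw v
  have hb : (0 : ℝ) < (I.beta v : ℝ) ^ (1 + ν) := by
    apply Real.rpow_pos_of_pos
    exact_mod_cast Nat.lt_of_lt_of_le one_pos (le_max_left _ _)
  have hout : {i | ∃ u, I.graph.Adj v u ∧ I.ident u = i} = I.ident '' I.outNbrs v := rfl
  have hex : ∃ x, x ∈ I.list v ∧ (I.outNbrs v).ncard ≤ I.defect v x := by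
    by_contra! hcon
    have hle : I.weight ν v ≤ (I.list v).card * (I.beta v : ℝ) ^ (1 + ν) := by
      rw [← nsmul_eq_mul]
      refine Finset.sum_le_card_nsmul _ _ _ fun x hx => ?_
      refine Real.rpow_le_rpow (by positivity) ?_ (by linarith)
      have h1 : I.defect v x + 1 ≤ I.beta v := (hcon x hx).trans_le (le_max_right _ _)
      exact_mod_cast h1
    have h2 := h (I.list v) (hI.list_subset v) (hI.list_card_le v)
    have h3 := hw v
    nlinarith
  have hmem := Nat.sInf_mem (s := {x | x ∈ I.list v ∧
    (I.ident '' I.outNbrs v).ncard ≤ I.defect v x}) (by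
      simpa [Set.ncard_image_of_injective _ hI.ident_injective, Set.Nonempty] using hex)
  simp only [Instance.localInput, hout]
  refine ⟨hmem.1, le_trans (Set.ncard_le_ncard (fun u hu => hu.1) (Set.toFinite _)) ?_⟩
  exact (Set.ncard_image_of_injective _ hI.ident_injective).symm.trans_le hmem.2

/-- Lists of one or two colors with defects `0` are unsolvable on the directed triangle. Hence a
weight of `β_v ^ (1 + ν) * K` can only suffice for such lists if `K` exceeds their size. -/
lemma lt_of_solvable {P : Globals} {Λ : ℕ} {ν K : ℝ} {T : ℕ} (hβ : 2 ≤ P.β) (hΔ : P.β ≤ P.Δ)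
    (hn : P.Δ < P.n) (hN : P.n ≤ P.N) (hΛ : Λ ≤ 2)
    (h : SolvableInRounds P 3 Λ (Finset.range Λ) ν K T) : (Λ : ℝ) < K := by
  by_contra! hK
  obtain ⟨A, hA⟩ := h
  have hnbr : ∀ u v : Fin 3, v = u + 1 ∨ u = v + 1 → u = v + 1 ∨ u = v + 2 := by decide
  have hproper : ∀ u v : Fin 3, v = u + 1 → (u : ℕ) ≠ v := by decide
  let I : Instance (Fin 3) :=
    { graph := ⟨fun u v => v = u + 1⟩
      ident := fun v => v
      initColor := fun v => v
      list := fun _ => Finset.range Λ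
      defect := fun _ _ => 0 }
  have hout : ∀ v, I.outNbrs v = {v + 1} := fun v => by ext u; rfl
  have hbeta : ∀ v, I.beta v = 1 := fun v => by simp [Instance.beta, hout]
  have hsol := hA (Fin 3) I
    { card_le := by simp; omega
      ident_lt := fun v => by have := v.2; change (v : ℕ) < _; omega
      ident_injective := Fin.val_injective
      deg_le := fun v => by
        have h1 : {u | I.IsNbr u v} ⊆ {v + 1, v + 2} := by
          intro u hu
          exact hnbr u v hu
        have h2 : I.deg v ≤ 2 := (Set.ncard_le_ncard h1 (Set.toFinite _)).trans
          (Set.ncard_insert_le _ _ |>.trans (by simp))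
        omega
      beta_le := fun v => by rw [hbeta]; omega
      initColor_lt := fun v => v.2
      initColor_proper := hproper
      list_subset := fun v => subset_rfl
      list_card_le := fun v => by simp [I] } (fun v => by
        simpa [hbeta, Instance.weight, I] using hK)
  have hlt : ∀ v, A.coloring I T v < Λ := fun v => by simpa [I] using (hsol v).1
  have hne : ∀ v : Fin 3, A.coloring I T (v + 1) ≠ A.coloring I T v := by
    intro v hv
    have h1 := (hsol v).2
    have h2 : {u | u ∈ I.outNbrs v ∧ A.coloring I T u = A.coloring I T v} = {v + 1} := by
      ext u
      simp only [hout, Set.mem_singleton_iff, Set.mem_ofPred_eq]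
      exact ⟨fun h => h.1, fun h => ⟨h, h ▸ hv⟩⟩
    rw [h2] at h1
    simp [I] at h1
  have a0 := hlt 0
  have a1 := hlt 1
  have a2 := hlt 2
  have b0 : A.coloring I T 1 ≠ A.coloring I T 0 := hne 0
  have b1 : A.coloring I T 2 ≠ A.coloring I T 1 := hne 1
  have b2 : A.coloring I T 0 ≠ A.coloring I T 2 := hne 2
  omega

/-! ### Cole–Vishkin color reduction in pseudoforests -/

lemma clog_lt_self {x : ℕ} (hx : 2 ≤ x) : Nat.clog 2 x < x := by
  have h := Nat.pow_pred_clog_lt_self (b := 2) (by norm_num) (x := x) (by omega)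
  have h2 : (Nat.clog 2 x).pred < 2 ^ (Nat.clog 2 x).pred := Nat.lt_two_pow_self
  have := Nat.clog_pos (b := 2) (by norm_num) hx
  simp only [Nat.pred_eq_sub_one] at *
  omega

lemma iterate_clog_le_one (m : ℕ) : (fun x : ℕ => Nat.clog 2 x)^[m] m ≤ 1 := by
  have h : ∀ k, (fun x : ℕ => Nat.clog 2 x)^[k] m ≤ max 1 (m - k) := by
    intro k
    induction k with
    | zero => simp
    | succ k ih =>
      rw [Function.iterate_succ_apply']
      rcases Nat.lt_or_ge ((fun x : ℕ => Nat.clog 2 x)^[k] m) 2 with h | h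
      · simp [Nat.clog_of_right_le_one (show (fun x : ℕ => Nat.clog 2 x)^[k] m ≤ 1 by omega)]
      · have := clog_lt_self h
        omega
  simpa using h m

lemma iterate_clog_logStar (m : ℕ) : (fun x : ℕ => Nat.clog 2 x)^[logStar m] m ≤ 1 :=
  Nat.sInf_mem (s := {k : ℕ | (fun x : ℕ => Nat.clog 2 x)^[k] m ≤ 1})
    ⟨m, iterate_clog_le_one m⟩

lemma logStar_le_self (m : ℕ) : logStar m ≤ m := Nat.sInf_le (iterate_clog_le_one m)

lemma logStar_le_logStar_clog_add_one (m : ℕ) : logStar m ≤ logStar (Nat.clog 2 m) + 1 :=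
  Nat.sInf_le (iterate_clog_logStar (Nat.clog 2 m))

lemma clog_four_mul_le (x : ℕ) : Nat.clog 2 (4 * x) ≤ Nat.clog 2 x + 2 := by
  apply Nat.clog_le_of_le_pow
  have := Nat.le_pow_clog (b := 2) (by norm_num) x
  rw [pow_add]
  omega

lemma logStar_eight_pow_le (x : ℕ) : logStar (8 ^ x) ≤ Nat.clog 2 x + 4 := by
  have h1 : Nat.clog 2 (8 ^ x) = 3 * x := by
    rw [show 8 = 2 ^ 3 by norm_num, ← pow_mul, Nat.clog_pow 2 _ (by norm_num)]
  have h2 := logStar_le_logStar_clog_add_one (8 ^ x)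
  have h3 := logStar_le_logStar_clog_add_one (3 * x)
  have h4 := logStar_le_self (Nat.clog 2 (3 * x))
  have h5 : Nat.clog 2 (3 * x) ≤ Nat.clog 2 (4 * x) := Nat.clog_mono_right _ (by omega)
  have h6 := clog_four_mul_le x
  rw [h1] at h2
  omega

/-- One step of Cole–Vishkin color reduction for a node of color `x` with a parent of color `y`:
the index of the first binary digit where `x` and `y` differ, together with this digit of `x`. -/
noncomputable def cvStep (x y : ℕ) : ℕ :=
  2 * sInf {i | x.testBit i ≠ y.testBit i} +
    (x.testBit (sInf {i | x.testBit i ≠ y.testBit i})).toNat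

lemma testBit_sInf_ne {x y : ℕ} (h : x ≠ y) :
    x.testBit (sInf {i | x.testBit i ≠ y.testBit i}) ≠
      y.testBit (sInf {i | x.testBit i ≠ y.testBit i}) := by
  refine Nat.sInf_mem (s := {i | x.testBit i ≠ y.testBit i}) ?_
  by_contra hcon
  refine h (Nat.eq_of_testBit_eq fun i => ?_)
  by_contra hi
  exact hcon ⟨i, hi⟩

lemma cvStep_ne_cvStep {x y : ℕ} (hxy : x ≠ y) (z : ℕ) : cvStep x y ≠ cvStep y z := by
  intro h
  have hx := testBit_sInf_ne hxy
  unfold cvStep at h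
  generalize sInf {i | x.testBit i ≠ y.testBit i} = i at *
  generalize sInf {i | y.testBit i ≠ z.testBit i} = j at *
  have h1 := Bool.toNat_lt (x.testBit i)
  have h2 := Bool.toNat_lt (y.testBit j)
  obtain rfl : i = j := by omega
  have h3 : (x.testBit i).toNat = (y.testBit i).toNat := by omega
  revert h3 hx
  cases x.testBit i <;> cases y.testBit i <;> simp

/-- Nodes without a parent keep the last binary digit of their color. -/
lemma cvStep_ne_mod_two {x y : ℕ} (hxy : x ≠ y) : cvStep x y ≠ y % 2 := by
  intro h
  have hx := testBit_sInf_ne hxy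
  unfold cvStep at h
  generalize sInf {i | x.testBit i ≠ y.testBit i} = i at *
  obtain rfl : i = 0 := by omega
  rw [Nat.testBit_zero, Nat.testBit_zero] at *
  rcases Nat.mod_two_eq_zero_or_one x with h1 | h1 <;>
    rcases Nat.mod_two_eq_zero_or_one y with h2 | h2 <;> simp_all

lemma cvStep_lt {x y M : ℕ} (hx : x < M) (hy : y < M) (hxy : x ≠ y) :
    cvStep x y < 2 * Nat.clog 2 M := by
  have hne := testBit_sInf_ne hxy
  have hM := Nat.le_pow_clog (b := 2) (by norm_num) M
  have hlt : sInf {i | x.testBit i ≠ y.testBit i} < Nat.clog 2 M := by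
    by_contra! hle
    refine hne ?_
    have hp := Nat.pow_le_pow_right (n := 2) (by norm_num) hle
    rw [Nat.testBit_lt_two_pow (by omega), Nat.testBit_lt_two_pow (by omega)]
  have h1 := Bool.toNat_lt (x.testBit (sInf {i | x.testBit i ≠ y.testBit i}))
  unfold cvStep
  omega

lemma two_mul_clog_max_le (y : ℕ) :
    2 * Nat.clog 2 (max 8 (4 * y)) ≤ max 8 (4 * Nat.clog 2 y) := by
  have h8 : Nat.clog 2 8 = 3 := by
    rw [show 8 = 2 ^ 3 by norm_num, Nat.clog_pow 2 _ (by norm_num)]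
  rcases Nat.lt_or_ge 2 y with h | h
  · have h1 := clog_four_mul_le y
    have h2 : Nat.clog 2 3 ≤ Nat.clog 2 y := Nat.clog_mono_right _ h
    have h3 : 1 < Nat.clog 2 3 := (Nat.lt_clog_iff_pow_lt (by norm_num)).mpr (by norm_num)
    rw [max_eq_right (by omega)]
    omega
  · rw [max_eq_left (by omega), h8]
    omega

/-- Parallel Cole–Vishkin color reduction. The `j`-th out-edges of all nodes form a pseudoforest;
`cvColor I t v j` is the color of `v` in the `j`-th pseudoforest after `t` steps. Out-edges are
sorted by the identifiers of their heads. For an index `j` that is too large, `Nat.nth` returns `0`,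
which is harmless because any neighbor may serve as a parent. -/
noncomputable def cvColor (I : Instance V) : ℕ → V → ℕ → ℕ
  | 0, v, _ => I.initColor v
  | t + 1, v, j =>
    match I.gather (cvColor I t) v (Nat.nth (· ∈ (I.localInput v).outIdents) j) with
    | some w => cvStep (cvColor I t v j) (w j)
    | none => cvColor I t v j % 2

lemma computableIn_cvColor (t : ℕ) : ComputableIn t (fun _ I v => cvColor I t v) := by
  induction t with
  | zero => exact ComputableIn.localInput.map fun l _ => l.initColor
  | succ t ih =>
    exact ih.gather.withInput.map fun s j =>
      match s.2.2 (Nat.nth (· ∈ s.1.outIdents) j) with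
      | some w => cvStep (s.2.1 j) (w j)
      | none => s.2.1 j % 2

lemma cvColor_succ_cases (I : Instance V) (hI : Function.Injective I.ident)
    (t : ℕ) (v : V) (j : ℕ) :
    (∃ u, I.IsNbr u v ∧ I.ident u = Nat.nth (· ∈ (I.localInput v).outIdents) j ∧
      cvColor I (t + 1) v j = cvStep (cvColor I t v j) (cvColor I t u j)) ∨
    ((∀ u, I.IsNbr u v → I.ident u ≠ Nat.nth (· ∈ (I.localInput v).outIdents) j) ∧
      cvColor I (t + 1) v j = cvColor I t v j % 2) := by
  by_cases h : ∃ u, I.IsNbr u v ∧ I.ident u = Nat.nth (· ∈ (I.localInput v).outIdents) j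
  · obtain ⟨u, hu, hj⟩ := h
    refine Or.inl ⟨u, hu, hj, ?_⟩
    have hg := I.gather_ident hI (cvColor I t) u v
    rw [if_pos hu, hj] at hg
    simp only [cvColor, hg]
  · push Not at h
    refine Or.inr ⟨h, ?_⟩
    have hg : I.gather (cvColor I t) v (Nat.nth (· ∈ (I.localInput v).outIdents) j) = none := by
      by_cases hi : ∃ u, I.ident u = Nat.nth (· ∈ (I.localInput v).outIdents) j
      · obtain ⟨u, hu⟩ := hi
        rw [← hu, I.gather_ident hI, if_neg fun hn => h u hn hu]
      · push Not at hi
        rw [Instance.gather, I.partialInv_eq_none hi]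
        rfl
    simp only [cvColor, hg]

lemma cvColor_ne (I : Instance V) (hI : Function.Injective I.ident)
    (hproper : ∀ u v, I.graph.Adj u v → I.initColor u ≠ I.initColor v) (t : ℕ) :
    ∀ u v j, I.IsNbr u v → I.ident u = Nat.nth (· ∈ (I.localInput v).outIdents) j →
      cvColor I t v j ≠ cvColor I t u j := by
  induction t with
  | zero =>
    intro u v j huv _
    exact huv.elim (fun h => (hproper u v h).symm) (fun h => hproper v u h)
  | succ t ih =>
    intro u v j huv hj
    have hne := ih u v j huv hj
    rcases cvColor_succ_cases I hI t v j with ⟨u', _, hj', hv⟩ | ⟨hno, _⟩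
    · obtain rfl : u' = u := hI (hj'.trans hj.symm)
      rw [hv]
      rcases cvColor_succ_cases I hI t u' j with ⟨w, _, _, hu⟩ | ⟨_, hu⟩
      · rw [hu]
        exact cvStep_ne_cvStep hne _
      · rw [hu]
        exact cvStep_ne_mod_two hne
    · exact absurd hj (hno u huv)

lemma cvColor_lt (I : Instance V) (hI : Function.Injective I.ident)
    (hproper : ∀ u v, I.graph.Adj u v → I.initColor u ≠ I.initColor v) {m : ℕ}
    (hm : ∀ v, I.initColor v < m) (t : ℕ) :
    ∀ v j, cvColor I t v j < max 8 (4 * (fun x : ℕ => Nat.clog 2 x)^[t] m) := by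
  induction t with
  | zero =>
    intro v j
    have := hm v
    simp only [cvColor, Function.iterate_zero, id]
    omega
  | succ t ih =>
    intro v j
    rw [Function.iterate_succ_apply']
    rcases cvColor_succ_cases I hI t v j with ⟨u, hu, hj, hv⟩ | ⟨_, hv⟩
    · rw [hv]
      exact (cvStep_lt (ih v j) (ih u j) (cvColor_ne I hI hproper t u v j hu hj)).trans_le
        (two_mul_clog_max_le _)
    · omega

/-- The first `β` entries of `c`, reduced modulo `8`, encoded as one color below `8 ^ β`. Once the
colors in all pseudoforests are below `8`, no information is lost. -/
noncomputable def cvCode (β : ℕ) (c : ℕ → ℕ) : ℕ :=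
  (finFunctionFinEquiv (m := 8) (n := β) fun j => Fin.ofNat 8 (c j) : Fin (8 ^ β))

lemma cvCode_lt (β : ℕ) (c : ℕ → ℕ) : cvCode β c < 8 ^ β := Fin.is_lt _

lemma cvCode_proper (I : Instance V) [Finite V] (hI : Function.Injective I.ident)
    (hproper : ∀ u v, I.graph.Adj u v → I.initColor u ≠ I.initColor v) {m β : ℕ}
    (hm : ∀ v, I.initColor v < m) (hβ : ∀ v, I.beta v ≤ β) {u v : V} (huv : I.graph.Adj u v) :
    cvCode β (cvColor I (logStar m) u) ≠ cvCode β (cvColor I (logStar m) v) := by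
  have hout : (I.localInput u).outIdents = I.ident '' I.outNbrs u := rfl
  have hfin : {i | i ∈ (I.localInput u).outIdents}.Finite := hout ▸ Set.toFinite (I.ident '' _)
  obtain ⟨j, hj, hju⟩ := Nat.exists_lt_card_finite_nth_eq
    (p := (· ∈ (I.localInput u).outIdents)) hfin (x := I.ident v) ⟨v, huv, rfl⟩
  have hjβ : j < β := by
    refine hj.trans_le ((le_trans ?_ (le_max_right _ _)).trans (hβ u))
    rw [← Set.ncard_eq_toFinset_card _ hfin]
    exact (Set.ncard_image_of_injective _ hI).le
  have hlt : ∀ w, cvColor I (logStar m) w j < 8 := fun w => by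
    have h1 := cvColor_lt I hI hproper hm (logStar m) w j
    have h2 := iterate_clog_logStar m
    omega
  intro heq
  have h1 := congrFun (finFunctionFinEquiv.injective (Fin.val_injective heq)) ⟨j, hjβ⟩
  have h2 := congrArg Fin.val h1
  simp only [Fin.ofNat, Nat.mod_eq_of_lt (hlt _)] at h2
  exact cvColor_ne I hI hproper (logStar m) v u j (Or.inr huv) hju.symm h2

/-! ### Color space reduction -/

/-- Simulation of an algorithm on a derived instance, followed by a translation of the resulting
colors. -/
lemma SolvableInRounds.of_simulation {P P' : Globals} {m m' Λ Λ' : ℕ} {𝒞 𝒞' : Finset ℕ}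
    {ν K K' : ℝ} {T T' : ℕ} {α : Type} (h : SolvableInRounds P' m' Λ' 𝒞' ν K' T')
    (Φ : ∀ V : Type, Instance V → Instance V) (aux : ∀ V : Type, Instance V → V → α)
    (g : α → ℕ → ℕ)
    (hid : ∀ (V : Type) (I : Instance V), (Φ V I).ident = I.ident)
    (hsub : ∀ (V : Type) (I : Instance V) (u v : V), (Φ V I).graph.Adj u v → I.graph.Adj u v)
    (hΦ : ComputableIn T (fun V I v => (Φ V I).localInput v))
    (haux : ComputableIn T aux)
    (hadm : ∀ (V : Type) [Fintype V] (I : Instance V), I.Admissible P m Λ 𝒞 →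
      (∀ v, (I.beta v : ℝ) ^ (1 + ν) * K ≤ I.weight ν v) →
      (Φ V I).Admissible P' m' Λ' 𝒞' ∧
      (∀ v, ((Φ V I).beta v : ℝ) ^ (1 + ν) * K' ≤ (Φ V I).weight ν v) ∧
      ∀ φ, (Φ V I).IsSolution φ → I.IsSolution fun v => g (aux V I v) (φ v)) :
    SolvableInRounds P m Λ 𝒞 ν K (T + T') := by
  obtain ⟨A, hA⟩ := h
  refine (((haux.mono (Nat.le_add_right T T')).pair
    (ComputableIn.simulate Φ hid hsub hΦ A T')).map fun s => g s.1 (A.output s.2.2)).solvable ?_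
  intro V _ I hI hw
  obtain ⟨h1, h2, h3⟩ := hadm V I hI hw
  exact h3 _ (hA V (Φ V I) h1 h2)

/-- The initial coloring is replaced by a coloring with `8 ^ β` colors, and the colors of the color
space are replaced by their ranks. -/
noncomputable def Instance.normalize (β T : ℕ) (𝒞 : Finset ℕ) (I : Instance V) : Instance V where
  graph := I.graph
  ident := I.ident
  initColor v := cvCode β (cvColor I T v)
  list v := (I.list v).image (Nat.count (· ∈ 𝒞))
  defect v y := I.defect v (Nat.nth (· ∈ 𝒞) y)

lemma SolvableInRounds.of_normalize {P : Globals} {m Λ M : ℕ} {𝒞 : Finset ℕ} {ν K : ℝ} {T : ℕ}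
    (hM : 𝒞.card ≤ M)
    (h : SolvableInRounds P (8 ^ P.β) Λ (Finset.range M) ν K T) :
    SolvableInRounds P m Λ 𝒞 ν K (logStar m + T) := by
  have hfin : {x | x ∈ 𝒞}.Finite := 𝒞.finite_toSet
  have hcount : ∀ x ∈ 𝒞, Nat.count (· ∈ 𝒞) x < M := fun x hx => by
    refine (Nat.count_lt_card hfin hx).trans_le (le_trans ?_ hM)
    exact Finset.card_le_card fun y hy => by simpa using hy
  have hnth : ∀ x ∈ 𝒞, Nat.nth (· ∈ 𝒞) (Nat.count (· ∈ 𝒞) x) = x := fun x hx => Nat.nth_count hx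
  refine h.of_simulation (fun _ I => I.normalize P.β (logStar m) 𝒞) (fun _ _ _ => ())
    (fun _ y => Nat.nth (· ∈ 𝒞) y) (fun _ _ => rfl) (fun _ _ _ _ => id) ?_ ?_ ?_
  · exact (computableIn_cvColor (logStar m)).withInput.map
      fun s : LocalInput × (ℕ → ℕ) =>
      { ident := s.1.ident
        initColor := cvCode P.β s.2
        outIdents := s.1.outIdents
        inIdents := s.1.inIdents
        list := s.1.list.image (Nat.count (· ∈ 𝒞))
        defect := fun y => s.1.defect (Nat.nth (· ∈ 𝒞) y) : LocalInput }
  · exact (ComputableIn.localInput.mono (Nat.zero_le _)).map fun _ => ()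
  · intro V _ I hI hw
    have hinj : ∀ v, Set.InjOn (Nat.count (· ∈ 𝒞)) (I.list v : Set ℕ) := fun v x hx y hy hxy => by
      rw [← hnth x (hI.list_subset v hx), ← hnth y (hI.list_subset v hy)]
      exact congrArg _ hxy
    refine ⟨⟨hI.card_le, hI.ident_lt, hI.ident_injective, hI.deg_le, hI.beta_le,
      fun v => cvCode_lt _ _, fun u v huv => cvCode_proper I hI.ident_injective
        hI.initColor_proper hI.initColor_lt hI.beta_le huv, fun v y hy => ?_, fun v =>
        Finset.card_image_le.trans (hI.list_card_le v)⟩, fun v => (hw v).trans_eq ?_, ?_⟩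
    · obtain ⟨x, hx, rfl⟩ := Finset.mem_image.mp hy
      exact Finset.mem_range.mpr (hcount x (hI.list_subset v hx))
    · simp only [Instance.weight, Instance.normalize]
      rw [Finset.sum_image (hinj v)]
      exact Finset.sum_congr rfl fun x hx => by rw [hnth x (hI.list_subset v hx)]
    · intro φ hφ
      have hrank : ∀ v, ∃ x ∈ I.list v, Nat.count (· ∈ 𝒞) x = φ v := fun v =>
        Finset.mem_image.mp (hφ v).1
      have hback : ∀ v, Nat.count (· ∈ 𝒞) (Nat.nth (· ∈ 𝒞) (φ v)) = φ v := fun v => by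
        obtain ⟨x, hx, hxv⟩ := hrank v
        rw [← hxv, hnth x (hI.list_subset v hx)]
      intro v
      constructor
      · obtain ⟨x, hx, hxv⟩ := hrank v
        simp only [← hxv, hnth x (hI.list_subset v hx), hx]
      · have hsub : {u | u ∈ I.outNbrs v ∧ Nat.nth (· ∈ 𝒞) (φ u) = Nat.nth (· ∈ 𝒞) (φ v)} ⊆
            {u | u ∈ I.outNbrs v ∧ φ u = φ v} := fun u hu => ⟨hu.1, by
          rw [← hback u, ← hback v]
          exact congrArg _ hu.2⟩
        exact (Set.ncard_le_ncard hsub (Set.toFinite _)).trans (hφ v).2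

/-- The weight of the colors in the `i`-th block `{x | x / S = i}` of the list of `v`. -/
noncomputable def blockWeight (ν : ℝ) (S : ℕ) (L : Finset ℕ) (d : ℕ → ℕ) (i : ℕ) : ℝ :=
  ∑ x ∈ L with x / S = i, ((d x : ℝ) + 1) ^ (1 + ν)

/-- The largest outdegree for which the weight of the `i`-th block is a factor `Q` above what is
required. -/
noncomputable def blockDefect (ν Q : ℝ) (S : ℕ) (L : Finset ℕ) (d : ℕ → ℕ) (i : ℕ) : ℕ :=
  ⌊(blockWeight ν S L d i / Q) ^ (1 + ν)⁻¹⌋₊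

/-- The instance in which every node has to choose the block of its color. -/
noncomputable def Instance.blockInstance (ν Q : ℝ) (S : ℕ) (I : Instance V) : Instance V where
  graph := I.graph
  ident := I.ident
  initColor := I.initColor
  list v := (I.list v).image (· / S)
  defect v := blockDefect ν Q S (I.list v) (I.defect v)

open Classical in
/-- The instance in which every node `v` has to choose the position of its color in the block
`ψ v`. Only edges inside blocks are left. Nodes without out-neighbors get a large defect: it does
not matter for them, but it gives them the weight that is required of nodes of outdegree `1`. -/
noncomputable def Instance.restrictToBlock (Q : ℝ) (S : ℕ) (I : Instance V) (ψ : V → ℕ) :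
    Instance V where
  graph := ⟨fun u v => I.graph.Adj u v ∧ ψ u = ψ v⟩
  ident := I.ident
  initColor := I.initColor
  list v := {x ∈ I.list v | x / S = ψ v}.image (· % S)
  defect v y :=
    if ∃ u, I.graph.Adj v u ∧ ψ v = ψ u then I.defect v (ψ v * S + y) else ⌈Q⌉₊

lemma blockWeight_nonneg (ν : ℝ) (S : ℕ) (L : Finset ℕ) (d : ℕ → ℕ) (i : ℕ) :
    0 ≤ blockWeight ν S L d i := Finset.sum_nonneg fun _ _ => by positivity

lemma blockWeight_div_le {ν Q : ℝ} (hν : 0 ≤ ν) (hQ : 0 < Q) (S : ℕ) (L : Finset ℕ) (d : ℕ → ℕ)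
    (i : ℕ) :
    blockWeight ν S L d i / Q ≤ ((blockDefect ν Q S L d i : ℝ) + 1) ^ (1 + ν) := by
  have h0 : 0 ≤ blockWeight ν S L d i / Q := div_nonneg (blockWeight_nonneg ..) hQ.le
  calc _ = ((blockWeight ν S L d i / Q) ^ (1 + ν)⁻¹) ^ (1 + ν) :=
        (Real.rpow_inv_rpow h0 (by linarith)).symm
    _ ≤ _ := Real.rpow_le_rpow (by positivity) (Nat.lt_floor_add_one _).le (by linarith)

lemma rpow_mul_le_blockWeight {ν Q : ℝ} (hν : 0 ≤ ν) (hQ : 0 < Q) {S : ℕ} {L : Finset ℕ}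
    {d : ℕ → ℕ} {i k : ℕ} (hk : k ≤ blockDefect ν Q S L d i) :
    (k : ℝ) ^ (1 + ν) * Q ≤ blockWeight ν S L d i := by
  have h0 : 0 ≤ blockWeight ν S L d i / Q := div_nonneg (blockWeight_nonneg ..) hQ.le
  rw [← le_div_iff₀ hQ, ← Real.rpow_inv_rpow h0 (show 1 + ν ≠ 0 by linarith)]
  refine Real.rpow_le_rpow (by positivity) ?_ (by linarith)
  exact le_trans (by exact_mod_cast hk) (Nat.floor_le (by positivity))

lemma Instance.blockInstance_spec {P : Globals} {m Λ p S : ℕ} {ν q Q : ℝ} (hν : 0 ≤ ν)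
    (hQ : 0 < Q) {V : Type} {I : Instance V}
    (hI : I.Admissible P m Λ (Finset.range (p * S)))
    (hw : ∀ v, (I.beta v : ℝ) ^ (1 + ν) * (q * Q) ≤ I.weight ν v) :
    (I.blockInstance ν Q S).Admissible P m p (Finset.range p) ∧
      ∀ v, ((I.blockInstance ν Q S).beta v : ℝ) ^ (1 + ν) * q ≤
        (I.blockInstance ν Q S).weight ν v := by
  have hsub : ∀ v, (I.blockInstance ν Q S).list v ⊆ Finset.range p := fun v i hi => by
    obtain ⟨x, hx, rfl⟩ := Finset.mem_image.mp hi
    exact Finset.mem_range.mpr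
      (Nat.div_lt_of_lt_mul (by simpa [mul_comm] using hI.list_subset v hx))
  refine ⟨⟨hI.card_le, hI.ident_lt, hI.ident_injective, hI.deg_le, hI.beta_le, hI.initColor_lt,
    hI.initColor_proper, hsub, fun v => (Finset.card_le_card (hsub v)).trans (by simp)⟩,
    fun v => ?_⟩
  have hsum : I.weight ν v = ∑ i ∈ (I.list v).image (· / S),
      blockWeight ν S (I.list v) (I.defect v) i :=
    (Finset.sum_fiberwise_of_maps_to (fun x hx => Finset.mem_image_of_mem _ hx) _).symm
  calc ((I.blockInstance ν Q S).beta v : ℝ) ^ (1 + ν) * q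
      = (I.beta v : ℝ) ^ (1 + ν) * (q * Q) / Q := by
        rw [← mul_assoc, mul_div_cancel_right₀ _ hQ.ne']; rfl
    _ ≤ I.weight ν v / Q := by gcongr; exact hw v
    _ ≤ _ := by
      rw [hsum, Finset.sum_div]
      exact Finset.sum_le_sum fun i _ => blockWeight_div_le hν hQ _ _ _ _

lemma div_mul_add_mod_eq {x S i : ℕ} (h : x / S = i) : i * S + x % S = x := by
  rw [← h, mul_comm]; exact Nat.div_add_mod x S

lemma Instance.outNbrs_restrictToBlock (Q : ℝ) (S : ℕ) (I : Instance V) (ψ : V → ℕ) (v : V) :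
    (I.restrictToBlock Q S ψ).outNbrs v = {u | u ∈ I.outNbrs v ∧ ψ u = ψ v} :=
  Set.ext fun _ => and_congr_right fun _ => eq_comm

lemma Instance.weight_restrictToBlock {ν Q : ℝ} {S : ℕ} {I : Instance V} {ψ : V → ℕ} {v : V}
    (h : ((I.restrictToBlock Q S ψ).outNbrs v).Nonempty) :
    (I.restrictToBlock Q S ψ).weight ν v = blockWeight ν S (I.list v) (I.defect v) (ψ v) := by
  have h' : ∃ u, I.graph.Adj v u ∧ ψ v = ψ u := h
  simp only [Instance.weight, Instance.restrictToBlock, if_pos h', blockWeight]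
  rw [Finset.sum_image]
  · refine Finset.sum_congr rfl fun x hx => ?_
    rw [div_mul_add_mod_eq (Finset.mem_filter.mp hx).2]
  · intro x hx y hy hxy
    rw [← div_mul_add_mod_eq (Finset.mem_filter.mp hx).2,
      ← div_mul_add_mod_eq (Finset.mem_filter.mp hy).2]
    exact congrArg _ hxy

/-- After the choice of blocks, the weight condition holds inside the blocks, and solutions inside
the blocks combine to a solution of the whole instance. -/
lemma Instance.restrictToBlock_spec {P : Globals} {m Λ S : ℕ} {𝒞 : Finset ℕ} {ν Q : ℝ}
    (hν : 0 ≤ ν) (hQ : 0 < Q) (hS : 0 < S) {V : Type} [Finite V] {I : Instance V}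
    (hI : I.Admissible P m Λ 𝒞) {ψ : V → ℕ} (hψ : (I.blockInstance ν Q S).IsSolution ψ) :
    (I.restrictToBlock Q S ψ).Admissible P m Λ (Finset.range S) ∧
    (∀ v, ((I.restrictToBlock Q S ψ).beta v : ℝ) ^ (1 + ν) * Q ≤
      (I.restrictToBlock Q S ψ).weight ν v) ∧
    ∀ φ, (I.restrictToBlock Q S ψ).IsSolution φ → I.IsSolution fun v => ψ v * S + φ v := by
  have hlist : ∀ v, ∀ y ∈ (I.restrictToBlock Q S ψ).list v,
      y < S ∧ ψ v * S + y ∈ I.list v := fun v y hy => by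
    obtain ⟨x, hx, rfl⟩ := Finset.mem_image.mp hy
    obtain ⟨hx1, hx2⟩ := Finset.mem_filter.mp hx
    refine ⟨Nat.mod_lt _ hS, ?_⟩
    simpa only [div_mul_add_mod_eq hx2] using hx1
  refine ⟨⟨hI.card_le, hI.ident_lt, hI.ident_injective, fun v => ?_, fun v => ?_,
    hI.initColor_lt, fun u v huv => hI.initColor_proper u v huv.1,
    fun v y hy => Finset.mem_range.mpr (hlist v y hy).1, fun v => ?_⟩, fun v => ?_, ?_⟩
  · refine (Set.ncard_le_ncard (fun u hu => ?_) (Set.toFinite _)).trans (hI.deg_le v)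
    exact Or.imp And.left And.left hu
  · refine (max_le_max le_rfl ?_).trans (hI.beta_le v)
    exact Set.ncard_le_ncard (fun u hu => hu.1) (Set.toFinite _)
  · exact Finset.card_image_le.trans ((Finset.card_filter_le _ _).trans (hI.list_card_le v))
  · have hout : (I.restrictToBlock Q S ψ).outNbrs v = {u | u ∈ I.outNbrs v ∧ ψ u = ψ v} :=
      I.outNbrs_restrictToBlock Q S ψ v
    rcases Set.eq_empty_or_nonempty ((I.restrictToBlock Q S ψ).outNbrs v) with h | h
    · have h' : ¬ ∃ u, I.graph.Adj v u ∧ ψ v = ψ u := fun ⟨u, hu⟩ => by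
        have : u ∈ (I.restrictToBlock Q S ψ).outNbrs v := hu
        rw [h] at this
        exact this
      obtain ⟨x, hx, hxv⟩ := Finset.mem_image.mp (hψ v).1
      have hmem : x % S ∈ (I.restrictToBlock Q S ψ).list v :=
        Finset.mem_image_of_mem _ (Finset.mem_filter.mpr ⟨hx, hxv⟩)
      have hdef : (I.restrictToBlock Q S ψ).defect v (x % S) = ⌈Q⌉₊ := if_neg h'
      have hsingle : (((I.restrictToBlock Q S ψ).defect v (x % S) : ℝ) + 1) ^ (1 + ν) ≤
          (I.restrictToBlock Q S ψ).weight ν v :=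
        Finset.single_le_sum (f := fun y =>
          (((I.restrictToBlock Q S ψ).defect v y : ℝ) + 1) ^ (1 + ν))
          (fun _ _ => by positivity) hmem
      refine le_trans ?_ hsingle
      rw [hdef, Instance.beta, h]
      simp only [Set.ncard_empty, zero_le_one, sup_of_le_left, Nat.cast_one, Real.one_rpow, one_mul]
      calc Q ≤ (⌈Q⌉₊ : ℝ) + 1 := (Nat.le_ceil Q).trans (by linarith)
        _ ≤ _ := Real.self_le_rpow_of_one_le (by simp) (by linarith)
    · rw [Instance.weight_restrictToBlock h]
      refine rpow_mul_le_blockWeight hν hQ (max_le ?_ ?_)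
      · refine le_trans ?_ (hψ v).2
        rw [Nat.succ_le_iff, Set.ncard_pos]
        rw [hout] at h
        exact h
      · rw [hout]
        exact (hψ v).2
  · intro φ hφ v
    have hlt : ∀ u, φ u < S := fun u => (hlist u _ (hφ u).1).1
    refine ⟨(hlist v _ (hφ v).1).2, ?_⟩
    have hsub : {u | u ∈ I.outNbrs v ∧ ψ u * S + φ u = ψ v * S + φ v} ⊆
        {u | u ∈ (I.restrictToBlock Q S ψ).outNbrs v ∧ φ u = φ v} := by
      rintro u ⟨hu, heq⟩
      have h1 := congrArg (· / S) heq
      have h2 := congrArg (· % S) heq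
      simp only [mul_comm _ S, Nat.mul_add_div hS, Nat.div_eq_of_lt (hlt _), Nat.mul_add_mod,
        Nat.mod_eq_of_lt (hlt _), add_zero] at h1 h2
      exact ⟨⟨hu, h1.symm⟩, h2⟩
    by_cases hex : ∃ u, I.graph.Adj v u ∧ ψ v = ψ u
    · refine (Set.ncard_le_ncard hsub (Set.toFinite _)).trans ((hφ v).2.trans_eq ?_)
      exact if_pos hex
    · have hempty : {u | u ∈ I.outNbrs v ∧ ψ u * S + φ u = ψ v * S + φ v} = ∅ :=
        Set.eq_empty_of_forall_notMem fun u hu => hex ⟨u, (hsub hu).1⟩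
      rw [hempty]
      simp

/-- Color space reduction: if the color space consists of `p` blocks of size `S`, then the nodes
can choose a block first, and then colors inside all blocks in parallel. One round in between is
used to learn which neighbors have chosen the same block. -/
lemma SolvableInRounds.colorSpaceReduction {P : Globals} {m Λ p S : ℕ} {ν q Q : ℝ} {T T' : ℕ}
    (hν : 0 ≤ ν) (hQ : 0 < Q) (hS : 0 < S)
    (h : SolvableInRounds P m p (Finset.range p) ν q T)
    (h' : SolvableInRounds P m Λ (Finset.range S) ν Q T') :
    SolvableInRounds P m Λ (Finset.range (p * S)) ν (q * Q) (T + 1 + T') := by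
  classical
  obtain ⟨A, hA⟩ := h
  let ψ : ∀ V : Type, Instance V → V → ℕ := fun V I => A.coloring (I.blockInstance ν Q S) T
  have hψ : ComputableIn T ψ := by
    have h1 := ComputableIn.simulate (T := 0) (fun _ I => I.blockInstance ν Q S)
      (fun _ _ => rfl) (fun _ _ _ _ => id)
      (ComputableIn.localInput.map fun l =>
        { l with
          list := l.list.image (· / S)
          defect := blockDefect ν Q S l.list l.defect }) A T
    rw [zero_add] at h1
    exact h1.map fun s => A.output s.2
  refine h'.of_simulation (fun V I => I.restrictToBlock Q S (ψ V I)) ψ (fun i y => i * S + y)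
    (fun _ _ => rfl) (fun _ _ _ _ => And.left) ?_ (hψ.mono (Nat.le_succ T)) ?_
  · refine (hψ.gather.withInput.map fun s : LocalInput × (ℕ × (ℕ → Option ℕ)) =>
      { ident := s.1.ident
        initColor := s.1.initColor
        outIdents := {i | i ∈ s.1.outIdents ∧ s.2.2 i = some s.2.1}
        inIdents := {i | i ∈ s.1.inIdents ∧ s.2.2 i = some s.2.1}
        list := {x ∈ s.1.list | x / S = s.2.1}.image (· % S)
        defect := fun y => if ∃ i, i ∈ s.1.outIdents ∧ s.2.2 i = some s.2.1 then
          s.1.defect (s.2.1 * S + y) else ⌈Q⌉₊ : LocalInput }).congr ?_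
    intro V I hI v
    have hout : ∀ i, (i ∈ (I.localInput v).outIdents ∧
        I.gather (ψ V I) v i = some (ψ V I v)) ↔
        ∃ u, (I.graph.Adj v u ∧ ψ V I v = ψ V I u) ∧ I.ident u = i := by
      intro i
      constructor
      · rintro ⟨⟨u, hu, rfl⟩, hg⟩
        rw [I.gather_ident hI, if_pos (show I.IsNbr u v from Or.inr hu)] at hg
        exact ⟨u, ⟨hu, (Option.some.inj hg).symm⟩, rfl⟩
      · rintro ⟨u, ⟨hu, hc⟩, rfl⟩
        refine ⟨⟨u, hu, rfl⟩, ?_⟩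
        rw [I.gather_ident hI, if_pos (show I.IsNbr u v from Or.inr hu), hc]
    have hin : ∀ i, (i ∈ (I.localInput v).inIdents ∧
        I.gather (ψ V I) v i = some (ψ V I v)) ↔
        ∃ u, (I.graph.Adj u v ∧ ψ V I u = ψ V I v) ∧ I.ident u = i := by
      intro i
      constructor
      · rintro ⟨⟨u, hu, rfl⟩, hg⟩
        rw [I.gather_ident hI, if_pos (show I.IsNbr u v from Or.inl hu)] at hg
        exact ⟨u, ⟨hu, Option.some.inj hg⟩, rfl⟩
      · rintro ⟨u, ⟨hu, hc⟩, rfl⟩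
        refine ⟨⟨u, hu, rfl⟩, ?_⟩
        rw [I.gather_ident hI, if_pos (show I.IsNbr u v from Or.inl hu), hc]
    have hex : (∃ i, ∃ u, (I.graph.Adj v u ∧ ψ V I v = ψ V I u) ∧ I.ident u = i) ↔
        ∃ u, I.graph.Adj v u ∧ ψ V I v = ψ V I u :=
      ⟨fun ⟨_, u, hu, _⟩ => ⟨u, hu⟩, fun ⟨u, hu⟩ => ⟨_, u, hu, rfl⟩⟩
    simp only [hout, hin, hex]
    rfl
  · intro V _ I hI hw
    obtain ⟨h1, h2⟩ := Instance.blockInstance_spec hν hQ hI hw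
    exact Instance.restrictToBlock_spec hν hQ hS hI (hA V _ h1 h2)

lemma SolvableInRounds.iterate_colorSpaceReduction {P : Globals} {m p B : ℕ} {ν q : ℝ}
    (hν : 0 ≤ ν) (hq : 0 < q) (hp : 0 < p)
    (h : ∃ T ≤ B, SolvableInRounds P m p (Finset.range p) ν q T) (Λ k : ℕ) :
    ∃ T ≤ (k + 1) * (B + 1),
      SolvableInRounds P m Λ (Finset.range (p ^ (k + 1))) ν (q ^ (k + 1)) T := by
  obtain ⟨T, hT, hs⟩ := h
  induction k with
  | zero =>
    refine ⟨T, by omega, ?_⟩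
    obtain ⟨A, hA⟩ := hs
    rw [zero_add, pow_one, pow_one]
    refine ⟨A, fun V _ I hI hw => hA V I ⟨hI.card_le, hI.ident_lt, hI.ident_injective, hI.deg_le,
      hI.beta_le, hI.initColor_lt, hI.initColor_proper, hI.list_subset, fun v => ?_⟩ hw⟩
    exact (Finset.card_le_card (hI.list_subset v)).trans (by simp)
  | succ k ih =>
    obtain ⟨T', hT', hs'⟩ := ih
    refine ⟨T + 1 + T', by nlinarith, ?_⟩
    rw [pow_succ' p, pow_succ' q]
    exact hs.colorSpaceReduction hν (by positivity) (by positivity) hs'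

/-! ### Choice of the parameters -/

lemma clog_two_le_logb {x : ℕ} (hx : 2 ≤ x) : (Nat.clog 2 x : ℝ) ≤ Real.logb 2 x + 1 := by
  have h := Nat.pow_pred_clog_lt_self (b := 2) (by norm_num) (x := x) (by omega)
  have hpos := Nat.clog_pos (b := 2) (by norm_num) hx
  have h1 : ((Nat.clog 2 x).pred : ℝ) ≤ Real.logb 2 x := by
    rw [Real.le_logb_iff_rpow_le (by norm_num) (by positivity), Real.rpow_natCast]
    exact_mod_cast h.le
  rw [Nat.pred_eq_sub_one, Nat.cast_sub hpos] at h1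
  push_cast at h1
  linarith

lemma nat_le_pow_of_two_le {X : ℝ} (hX : 2 ≤ X) (n : ℕ) : (n : ℝ) ≤ X ^ n :=
  calc (n : ℝ) ≤ (2 : ℝ) ^ n := by exact_mod_cast Nat.lt_two_pow_self.le
    _ ≤ X ^ n := by gcongr

lemma le_two_rpow_self {s : ℝ} (hs : 1 ≤ s) : s ≤ (2 : ℝ) ^ s := by
  have h := one_add_mul_self_le_rpow_one_add (show (-1 : ℝ) ≤ 1 by norm_num) hs
  norm_num at h
  linarith

lemma mul_pow_lt {b β : ℕ} (hβ : 2 ≤ β) : ((b * β ^ b : ℕ) : ℝ) < (β : ℝ) ^ (2 * b) := by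
  have h : b < β ^ b := Nat.lt_two_pow_self.trans_le (Nat.pow_le_pow_left hβ b)
  have : b * β ^ b < β ^ (2 * b) := by
    rw [two_mul, pow_add]
    exact Nat.mul_lt_mul_of_pos_right h (by positivity)
  exact_mod_cast this

/-- Bound on the number of rounds of the iterated color space reduction: `k + 1` levels, each with
one run of the given algorithm for lists of size `p` (`l` is the `log*` of the number of initial
colors) and one extra round. -/
lemma rounds_le {a b B k p l : ℕ} {X s L : ℝ} (hs : 1 ≤ s) (hsX : s ≤ X) (hX : 2 ≤ X)
    (hL : L ≤ s ^ 2) (hp : (p : ℝ) ≤ X ^ 2) (hl : (l : ℝ) ≤ L + 5) (hB : B = a * p ^ a + a * l)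
    (hk : (k : ℝ) ≤ 2 * b * L / s + 1) :
    (((k + 1) * (B + 1) : ℕ) : ℝ) ≤ X ^ (9 * a + 2 * b + 6) := by
  have hX1 : 1 ≤ X := by linarith
  have hk1 : (k : ℝ) + 1 ≤ (2 * b + 2 : ℕ) * X := by
    have : 2 * b * L / s ≤ 2 * b * s := by
      rw [div_le_iff₀ (by linarith)]
      nlinarith [mul_le_mul_of_nonneg_left hL (show (0 : ℝ) ≤ 2 * b by positivity)]
    have h2 : 2 * (b : ℝ) * s ≤ 2 * b * X := by gcongr
    push_cast
    nlinarith
  have hle : ∀ {n : ℕ}, n ≤ 2 * a + 2 → X ^ n ≤ X ^ (2 * a + 2) := fun h =>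
    pow_le_pow_right₀ hX1 h
  have hpa : (p : ℝ) ^ a ≤ X ^ (2 * a + 2) := by
    calc (p : ℝ) ^ a ≤ (X ^ 2) ^ a := by gcongr
      _ = X ^ (2 * a) := (pow_mul ..).symm
      _ ≤ _ := hle (by omega)
  have hl6 : (l : ℝ) ≤ 6 * X ^ (2 * a + 2) := by
    have h1 : s ^ 2 ≤ X ^ 2 := by gcongr
    have h2 : X ^ 2 ≤ X ^ (2 * a + 2) := hle (by omega)
    have h3 : 1 ≤ X ^ (2 * a + 2) := one_le_pow₀ hX1
    linarith
  have hB1 : (B : ℝ) + 1 ≤ (7 * a + 1 : ℕ) * X ^ (2 * a + 2) := by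
    have h1 := mul_le_mul_of_nonneg_left hpa (Nat.cast_nonneg (α := ℝ) a)
    have h2 := mul_le_mul_of_nonneg_left hl6 (Nat.cast_nonneg (α := ℝ) a)
    have h3 : 1 ≤ X ^ (2 * a + 2) := one_le_pow₀ hX1
    rw [hB]
    push_cast
    linarith
  calc (((k + 1) * (B + 1) : ℕ) : ℝ) = ((k : ℝ) + 1) * ((B : ℝ) + 1) := by push_cast; rfl
    _ ≤ ((2 * b + 2 : ℕ) * X) * ((7 * a + 1 : ℕ) * X ^ (2 * a + 2)) := by gcongr
    _ ≤ (X ^ (2 * b + 2) * X) * (X ^ (7 * a + 1) * X ^ (2 * a + 2)) := by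
      gcongr <;> exact nat_le_pow_of_two_le hX _
    _ = X ^ (9 * a + 2 * b + 6) := by ring

/-- The iterated color space reduction with `2 ^ s ≤ p ≤ 4 ^ s` blocks on every level, where
`s = √(L * l)`, `L = log β` and `l = log K`. -/
lemma exists_solvable_of_blocks {P : Globals} {ν q K s L l : ℝ} {a b p : ℕ} (hν : 0 ≤ ν)
    (hq : 0 < q) (hqK : q ≤ K) (hs : 1 ≤ s) (hsL : s ^ 2 = L * l) (hl : 1 ≤ l) (hls : l ≤ s)
    (hL : 1 ≤ L) (hβL : (2 : ℝ) ^ L = P.β) (hKl : (2 : ℝ) ^ l = K) (hβ : 2 ≤ P.β)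
    (hp : (2 : ℝ) ^ s ≤ p) (hp' : (p : ℝ) ≤ ((2 : ℝ) ^ s) ^ 2)
    (hstar : (logStar (8 ^ P.β) : ℝ) ≤ L + 5)
    (H : ∃ T ≤ a * p ^ a + a * logStar (8 ^ P.β),
      SolvableInRounds P (8 ^ P.β) p (Finset.range p) ν q T)
    (Λ m : ℕ) {𝒞 : Finset ℕ} (h𝒞 : 𝒞.card ≤ b * P.β ^ b) :
    ∃ T : ℕ, (T : ℝ) ≤ ((2 : ℝ) ^ s) ^ (9 * a + 2 * b + 6) + logStar m ∧
      SolvableInRounds P m Λ 𝒞 ν (((2 : ℝ) ^ s) ^ (9 * a + 2 * b + 6)) T := by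
  have hs0 : 0 < s := by linarith
  have hX2 : 2 ≤ (2 : ℝ) ^ s := Real.self_le_rpow_of_one_le (by norm_num) hs
  have hXpow : ∀ {i j : ℕ}, i ≤ j → ((2 : ℝ) ^ s) ^ i ≤ ((2 : ℝ) ^ s) ^ j := fun h =>
    pow_le_pow_right₀ (by linarith) h
  have hsX := le_two_rpow_self hs
  have hcast : ∀ (x : ℝ) (n : ℕ), (2 : ℝ) ^ (x * n) = ((2 : ℝ) ^ x) ^ n := fun x n =>
    Real.rpow_mul_natCast (by norm_num) x n
  have hp2 : 2 ≤ p := by exact_mod_cast hX2.trans hp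
  -- With `k` chosen like this, `p ^ (k + 1)` exceeds the size of the color space.
  have hk0 : 0 ≤ 2 * b * L / s := by positivity
  have hk := (Nat.ceil_lt_add_one hk0).le
  have hk' := Nat.le_ceil (2 * b * L / s)
  generalize ⌈2 * b * L / s⌉₊ = k at hk hk'
  obtain ⟨T, hT, hsolv⟩ := SolvableInRounds.iterate_colorSpaceReduction hν hq (by omega) H Λ k
  have hcard : 𝒞.card ≤ p ^ (k + 1) := by
    have h1 : (P.β : ℝ) ^ (2 * b) ≤ (p : ℝ) ^ (k + 1) :=
      calc (P.β : ℝ) ^ (2 * b) = (2 : ℝ) ^ (L * (2 * b : ℕ)) := by rw [hcast, hβL]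
        _ ≤ (2 : ℝ) ^ (s * k) := by
            rw [div_le_iff₀ hs0] at hk'
            refine Real.rpow_le_rpow_of_exponent_le (by norm_num) ?_
            push_cast
            linarith
        _ = ((2 : ℝ) ^ s) ^ k := hcast s k
        _ ≤ ((2 : ℝ) ^ s) ^ (k + 1) := hXpow (by omega)
        _ ≤ _ := by gcongr
    refine h𝒞.trans ?_
    exact_mod_cast (mul_pow_lt hβ).le.trans h1
  have hK : q ^ (k + 1) ≤ ((2 : ℝ) ^ s) ^ (9 * a + 2 * b + 6) := by
    have hks : l * (k + 1 : ℕ) ≤ s * (2 * b + 2 : ℕ) := by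
      have h1 : 2 * b * L / s * l = 2 * b * s := by
        rw [div_mul_eq_mul_div, div_eq_iff hs0.ne']
        linear_combination (-2 * (b : ℝ)) * hsL
      have h2 := mul_le_mul_of_nonneg_right hk (show 0 ≤ l by linarith)
      push_cast
      linarith
    calc q ^ (k + 1) ≤ K ^ (k + 1) := by gcongr
      _ = (2 : ℝ) ^ (l * (k + 1 : ℕ)) := by rw [hcast, hKl]
      _ ≤ (2 : ℝ) ^ (s * (2 * b + 2 : ℕ)) :=
          Real.rpow_le_rpow_of_exponent_le (by norm_num) hks
      _ = ((2 : ℝ) ^ s) ^ (2 * b + 2) := hcast _ _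
      _ ≤ _ := hXpow (by omega)
  refine ⟨logStar m + T, ?_, (hsolv.mono hK).of_normalize hcard⟩
  have hLs : L ≤ s ^ 2 := by
    rw [hsL]
    exact le_mul_of_one_le_right (by linarith) hl
  have hrounds := rounds_le (a := a) (b := b) hs hsX hX2 hLs hp' hstar rfl hk
  have hTr : (T : ℝ) ≤ ((2 : ℝ) ^ s) ^ (9 * a + 2 * b + 6) :=
    le_trans (by exact_mod_cast hT) hrounds
  rw [Nat.cast_add]
  linarith

end OLDC

theorem mainTheorem7 (a b : ℕ) :
    ∃ c : ℝ, 0 < c ∧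
      ∀ (ν : ℝ) (κ : ℕ → ℝ) (P : OLDC.Globals),
        0 ≤ ν → Monotone κ → 2 ≤ P.β → P.β ≤ P.Δ → P.Δ < P.n → P.n ≤ P.N →
        (∀ (Λ m : ℕ) (𝒞 : Finset ℕ), 1 ≤ Λ →
          ∃ T : ℕ, T ≤ a * Λ ^ a + a * OLDC.logStar m ∧
            OLDC.SolvableInRounds P m Λ 𝒞 ν (κ Λ) T) →
        ∀ (Λ m : ℕ) (𝒞 : Finset ℕ), 1 ≤ Λ → 𝒞.card ≤ b * P.β ^ b →
          ∃ T : ℕ,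
            (T : ℝ) ≤ (2 : ℝ) ^ (c * √(Real.logb 2 P.β * Real.logb 2 (κ Λ)))
              + c * OLDC.logStar m ∧
            OLDC.SolvableInRounds P m Λ 𝒞 ν
              ((2 : ℝ) ^ (c * √(Real.logb 2 P.β * Real.logb 2 (κ Λ)))) T := by
  refine ⟨(9 * a + 2 * b + 6 : ℕ), by positivity, ?_⟩
  intro ν κ P hν hκ hβ hΔ hn hN H Λ m 𝒞 hΛ h𝒞
  have hκ1 : ∀ Λ : ℕ, 1 ≤ Λ → Λ ≤ 2 → (Λ : ℝ) < κ Λ := fun Λ h1 h2 => by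
    obtain ⟨T, -, hT⟩ := H Λ 3 (Finset.range Λ) h1
    exact OLDC.lt_of_solvable hβ hΔ hn hN h2 hT
  have hβ' : (2 : ℝ) ≤ P.β := by exact_mod_cast hβ
  have hL : 1 ≤ Real.logb 2 P.β := by
    rw [Real.le_logb_iff_rpow_le (by norm_num) (by linarith), Real.rpow_one]
    exact hβ'
  have hκΛ : 1 < κ Λ := lt_of_lt_of_le (by simpa using hκ1 1 le_rfl (by norm_num)) (hκ hΛ)
  have hl : 0 < Real.logb 2 (κ Λ) := Real.logb_pos (by norm_num) hκΛ
  have hβL : (2 : ℝ) ^ Real.logb 2 P.β = P.β :=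
    Real.rpow_logb (by norm_num) (by norm_num) (by linarith)
  have hκl : (2 : ℝ) ^ Real.logb 2 (κ Λ) = κ Λ :=
    Real.rpow_logb (by norm_num) (by norm_num) (by linarith)
  have hclog := OLDC.clog_two_le_logb hβ
  set L := Real.logb 2 P.β with hLdef
  set l := Real.logb 2 (κ Λ) with hldef
  have hs0 : 0 < √(L * l) := Real.sqrt_pos.mpr (by positivity)
  have hs2 : √(L * l) ^ 2 = L * l := Real.sq_sqrt (by positivity)
  set s := √(L * l) with hsdef
  have hXc : (2 : ℝ) ^ (((9 * a + 2 * b + 6 : ℕ) : ℝ) * s) =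
      ((2 : ℝ) ^ s) ^ (9 * a + 2 * b + 6) := by
    rw [mul_comm, Real.rpow_mul_natCast (by norm_num)]
  rw [hXc]
  have hX1 : 1 < (2 : ℝ) ^ s := Real.one_lt_rpow (by norm_num) hs0
  have hXpow : ∀ {i j : ℕ}, i ≤ j → ((2 : ℝ) ^ s) ^ i ≤ ((2 : ℝ) ^ s) ^ j := fun h =>
    pow_le_pow_right₀ hX1.le h
  rcases hΛ.eq_or_lt with rfl | hΛ2
  · refine ⟨0, by simp; positivity, OLDC.solvable_zero_of_list_card_lt hν fun S _ hS => ?_⟩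
    calc (S.card : ℝ) ≤ 1 := by exact_mod_cast hS
      _ < _ := one_lt_pow₀ hX1 (by omega)
  have hl1 : 1 < l := by
    rw [hldef, Real.lt_logb_iff_rpow_lt (by norm_num) (by linarith), Real.rpow_one]
    exact lt_of_lt_of_le (by simpa using hκ1 2 (by norm_num) le_rfl) (hκ hΛ2)
  have hs1 : 1 ≤ s := by nlinarith
  have hX2 : 2 ≤ (2 : ℝ) ^ s := Real.self_le_rpow_of_one_le (by norm_num) hs1
  have hb := OLDC.mul_pow_lt (b := b) hβ
  rcases le_or_gt L l with hLl | hlL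
  · -- The color space is smaller than the required weight.
    refine ⟨0, by simp; positivity, OLDC.solvable_zero_of_list_card_lt hν fun S hS _ => ?_⟩
    have hLs : L ≤ s := by nlinarith
    calc (S.card : ℝ) ≤ ((b * P.β ^ b : ℕ) : ℝ) := by
          exact_mod_cast (Finset.card_le_card hS).trans h𝒞
      _ < (P.β : ℝ) ^ (2 * b) := hb
      _ ≤ ((2 : ℝ) ^ s) ^ (2 * b) := by
          rw [← hβL]; gcongr; norm_num
      _ ≤ _ := hXpow (by omega)
  have hls : l ≤ s := by nlinarith
  have hκX : κ Λ ≤ (2 : ℝ) ^ s := by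
    rw [← hκl]; gcongr; norm_num
  have hpX : (2 : ℝ) ^ s ≤ ⌈(2 : ℝ) ^ s⌉₊ := Nat.le_ceil _
  have hpX2 : (⌈(2 : ℝ) ^ s⌉₊ : ℝ) ≤ ((2 : ℝ) ^ s) ^ 2 := by
    have := (Nat.ceil_lt_add_one (show 0 ≤ (2 : ℝ) ^ s by positivity)).le
    nlinarith
  set p := ⌈(2 : ℝ) ^ s⌉₊ with hpdef
  set X := (2 : ℝ) ^ s with hXdef
  rcases le_or_gt Λ p with hΛp | hpΛ
  · obtain ⟨T, hT, hsolv⟩ := H Λ m 𝒞 hΛ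
    refine ⟨T, ?_, hsolv.mono (hκX.trans (by simpa using hXpow (i := 1) (by omega)))⟩
    have hΛX : (Λ : ℝ) ≤ X ^ 2 := le_trans (by exact_mod_cast hΛp) hpX2
    have h1 : (a * Λ ^ a : ℝ) ≤ X ^ (9 * a + 2 * b + 6) :=
      calc (a * Λ ^ a : ℝ) ≤ X ^ a * (X ^ 2) ^ a := by
            gcongr; exact OLDC.nat_le_pow_of_two_le hX2 a
        _ = X ^ (3 * a) := by ring
        _ ≤ _ := hXpow (by omega)
    have h2 : (a * OLDC.logStar m : ℝ) ≤ (9 * a + 2 * b + 6 : ℕ) * OLDC.logStar m := by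
      gcongr; omega
    calc (T : ℝ) ≤ ((a * Λ ^ a + a * OLDC.logStar m : ℕ) : ℝ) := by exact_mod_cast hT
      _ ≤ _ := by push_cast at h1 h2 ⊢; linarith
  · have hstar : (OLDC.logStar (8 ^ P.β) : ℝ) ≤ L + 5 := by
      have : (OLDC.logStar (8 ^ P.β) : ℝ) ≤ (Nat.clog 2 P.β + 4 : ℕ) := by
        exact_mod_cast OLDC.logStar_eight_pow_le P.β
      push_cast at this
      linarith
    have hp1 : 1 ≤ p := Nat.one_le_ceil_iff.mpr (by positivity)
    have hκp : 0 < κ p :=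
      one_pos.trans (lt_of_lt_of_le (by simpa using hκ1 1 le_rfl (by norm_num)) (hκ hp1))
    obtain ⟨T, hT, hsolv⟩ := OLDC.exists_solvable_of_blocks hν hκp (hκ hpΛ.le) hs1 hs2 hl1.le hls
      hL hβL hκl hβ hpX hpX2 hstar (H p (8 ^ P.β) (Finset.range p) hp1) Λ m h𝒞
    refine ⟨T, hT.trans ?_, hsolv⟩
    gcongr
    refine le_mul_of_one_le_left (Nat.cast_nonneg _) ?_
    exact_mod_cast (show 1 ≤ 9 * a + 2 * b + 6 by omega)
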